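/- Let $G$ be a connected finite simple graph with $V(G)=\{1,\dots,n\}$ and $E(G)=\{e_1,\dots,e_m\}$. Let $f_1,\dots,f_n,g_1,\dots,g_m$ be the standard basis of $\mathbb{Z}^n\oplus\mathbb{Z}^m$. For each edge $e=e_k=ij$ with $i<j$, set $z(e)=f_i-f_j+g_k$ and $z'(e)=-f_i+f_j+g_k$. Let $N_0$ be the $n\times m$ matrix whose $k$-th column, for $e_k=ij$ with $i<j$, has entry $1$ in row $i$, entry $-1$ in row $j$, and $0$ elsewhere. For $I\subset\{1,\dots,n\}$, let $E(I)$ be the set of edges of $G$ with exactly one end in $I$. Let $r_i$, $s_j$, $a_e\le b_e$, $c_e\le d_e$ be integers ($1\le i\le n$, $1\le j\le m$, $e\in E(G)$). Then there exist integers $a_e\le x_e\le b_e$ and $c_e\le y_e\le d_e$ ($e\in E(G)$) such that $$\sum_{i=1}^n r_i f_i+\sum_{j=1}^m s_j g_j=\sum_{e\in E(G)} x_e z(e)+\sum_{e\in E(G)} y_e z'(e)$$ if and only if the following three conditions hold. (1) With $r=(r_1,\dots,r_n)^T$ and $s=(s_1,\dots,s_m)^T$, every entry $t_i$ of the vector $t=N_0s+r$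 is even, and $\sum_{i=1}^n t_i=0$. (2) For all sets $\emptyset\ne I\subsetneq\{1,\dots,n\}$ and $J\subset E(I)$ such that the induced subgraphs of $G$ on $I$ and on $\{1,\dots,n\}\setminus I$ are connected, $$\sum_{i\in I} r_i+\sum_{e_k\in E(I)\setminus J}s_k-\sum_{e_k\in J}s_k\le 2\sum_{\substack{e=ij\notin J,\ i<j\\ i\in I,\ j\notin I}} b_e-2\sum_{\substack{e=ij\in J,\ i<j\\ i\notin I,\ j\in I}} a_e+2\sum_{\substack{e=ij\notin J,\ i<j\\ i\notin I,\ j\in I}} d_e-2\sum_{\substack{e=ij\in J,\ i<j\\ i\in I,\ j\notin I}} c_e,$$ where all the sums on the right are over edges $e\in E(G)$. (3) For every edge $e=e_k\in E(G)$ such that the graph $G-e_k$ is connected, $a_e+c_e\le s_k\le b_e+d_e$. -/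

import Mathlib

open scoped Matrix

namespace EdgeBox

variable {n m : ℕ} {G : SimpleGraph (Fin n)}

/-- The standard basis vector `f_i` of `ℤⁿ ⊕ ℤᵐ`. -/
def f (m : ℕ) (i : Fin n) : (Fin n → ℤ) × (Fin m → ℤ) := (Pi.single i 1, 0)

/-- The standard basis vector `g_k` of `ℤⁿ ⊕ ℤᵐ`. -/
def g (n : ℕ) (k : Fin m) : (Fin n → ℤ) × (Fin m → ℤ) := (0, Pi.single k 1)

/-- The smaller end of an edge; it is the tail of the edge in the orientation of `G`
from smaller to larger vertices. -/
def lo (e : G.edgeSet) : Fin n := Sym2.inf (e : Sym2 (Fin n))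

/-- The larger end of an edge; it is the head of the edge in the orientation of `G`
from smaller to larger vertices. -/
def hi (e : G.edgeSet) : Fin n := Sym2.sup (e : Sym2 (Fin n))

/-- `z(e) = f_i - f_j + g_k` for the edge `e = e_k = ij` with `i < j`, where `ε` is the
enumeration `e_1, …, e_m` of the edges. -/
def z (ε : Fin m ≃ G.edgeSet) (e : G.edgeSet) : (Fin n → ℤ) × (Fin m → ℤ) :=
  f m (lo e) - f m (hi e) + g n (ε.symm e)

/-- `z'(e) = -f_i + f_j + g_k` for the edge `e = e_k = ij` with `i < j`. -/
def z' (ε : Fin m ≃ G.edgeSet) (e : G.edgeSet) : (Fin n → ℤ) × (Fin m → ℤ) :=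
  -f m (lo e) + f m (hi e) + g n (ε.symm e)

/-- The directed incidence matrix `N_0` of the orientation of `G` in which every edge is
directed from its smaller to its larger end. -/
def N₀ (ε : Fin m ≃ G.edgeSet) : Matrix (Fin n) (Fin m) ℤ :=
  Matrix.of fun i k => if i = lo (ε k) then 1 else if i = hi (ε k) then -1 else 0

/-- `E(I)`: the set of edges of `G` with exactly one end in `I`. -/
def cut (G : SimpleGraph (Fin n)) [DecidableRel G.Adj] (I : Finset (Fin n)) :
    Finset G.edgeSet :=
  Finset.univ.filter fun e => ∃ i ∈ I, ∃ j ∉ I, (e : Sym2 (Fin n)) = s(i, j)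

end EdgeBox

/-!
Since `y = s - x` is forced, the representation amounts to an integral flow `x` with net outflow
`(N₀ s + r) / 2` and bounds `max a (s - d) ≤ x ≤ min b (s - c)`, so the question is settled by
Hoffman's circulation theorem. The capacity of a cut takes the tighter of two bounds on each of its
edges, and the sets `J` in condition (2) run through all ways of choosing one of the two.

Cut inequalities add up when a side of the cut falls into two parts without edges between them, so
it is enough to ask for those whose two sides are both connected. The lower bound of a bridge is at
most its upper bound by the cut inequalities of its two sides; for the other edges this is
condition (3).

Hoffman's theorem is proved by fixing the flow one edge at a time: by submodularity of the capacity,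
the constraints on an edge from the cuts it leaves and from those it enters are compatible.
-/

namespace EdgeBox

section Network

variable {V E R : Type*} [DecidableEq V] (tail head : E → V) [AddCommGroup R]

/-- The capacity, out of the vertex set `I`, of the edge `e` of a network whose flows are bounded
below by `l` and above by `u`: a lower bound on an edge entering `I` counts negatively. -/
def edgeCapacity (l u : E → R) (I : Finset V) (e : E) : R :=
  if tail e ∈ I then (if head e ∈ I then 0 else u e) else (if head e ∈ I then -l e else 0)

theorem edgeCapacity_inter_add_union_le [LinearOrder R] [IsOrderedAddMonoid R] {l u : E → R} {e : E}
    (h : l e ≤ u e) (I K : Finset V) :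
    edgeCapacity tail head l u (I ∩ K) e + edgeCapacity tail head l u (I ∪ K) e ≤
      edgeCapacity tail head l u I e + edgeCapacity tail head l u K e := by
  simp only [edgeCapacity, Finset.mem_inter, Finset.mem_union]
  grind

variable [Fintype E]

/-- The capacity of the cut of all edges with exactly one end in `I`, counted out of `I`. -/
def cutCapacity (l u : E → R) (I : Finset V) : R :=
  ∑ e, edgeCapacity tail head l u I e

/-- The net outflow of the edge function `x` at each vertex. -/
def netOutflow (x : E → R) (i : V) : R :=
  ∑ e with tail e = i, x e - ∑ e with head e = i, x e

theorem netOutflow_sub (x y : E → R) :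
    netOutflow tail head (x - y) = netOutflow tail head x - netOutflow tail head y := by
  ext i
  simp only [netOutflow, Pi.sub_apply, Finset.sum_sub_distrib]
  abel

theorem sum_netOutflow (x : E → R) (I : Finset V) :
    ∑ i ∈ I, netOutflow tail head x i = cutCapacity tail head x x I := by
  simp only [netOutflow, Finset.sum_sub_distrib, Finset.sum_fiberwise_eq_sum_filter]
  simp only [cutCapacity, Finset.sum_filter, ← Finset.sum_sub_distrib, edgeCapacity]
  refine Finset.sum_congr rfl fun e _ => ?_
  split_ifs <;> simp

theorem cutCapacity_empty (l u : E → R) : cutCapacity tail head l u ∅ = 0 := by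
  simp [cutCapacity, edgeCapacity]

theorem cutCapacity_compl [Fintype V] (l u : E → R) (I : Finset V) :
    cutCapacity tail head l u Iᶜ = cutCapacity tail head (-u) (-l) I := by
  refine Finset.sum_congr rfl fun e _ => ?_
  simp only [edgeCapacity, Finset.mem_compl, Pi.neg_apply]
  split_ifs <;> simp

theorem cutCapacity_univ [Fintype V] (l u : E → R) :
    cutCapacity tail head l u Finset.univ = 0 := by
  rw [← Finset.compl_empty, cutCapacity_compl, cutCapacity_empty]

theorem cutCapacity_update [DecidableEq E] (l u : E → R) (I : Finset V) (e : E) (v : R) :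
    cutCapacity tail head (Function.update l e v) (Function.update u e v) I =
      cutCapacity tail head l u I +
        if tail e ∈ I ∧ head e ∉ I then v - u e
        else if tail e ∉ I ∧ head e ∈ I then l e - v else 0 := by
  rw [← sub_eq_iff_eq_add', cutCapacity, cutCapacity, ← Finset.sum_sub_distrib,
    Fintype.sum_eq_single e]
  · simp only [edgeCapacity, Function.update_self]
    grind
  · intro k hk
    simp only [edgeCapacity, Function.update_of_ne hk, sub_self]

variable [LinearOrder R] [IsOrderedAddMonoid R]

theorem cutCapacity_mono {l l' u u' : E → R} (hl : l' ≤ l) (hu : u ≤ u') (I : Finset V) :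
    cutCapacity tail head l u I ≤ cutCapacity tail head l' u' I := by
  refine Finset.sum_le_sum fun e _ => ?_
  unfold edgeCapacity
  split_ifs
  exacts [le_rfl, hu e, neg_le_neg (hl e), le_rfl]

theorem cutCapacity_inter_add_union_add_le {l u : E → R} (hlu : l ≤ u) {I K : Finset V} {e : E}
    (heI : tail e ∈ I ∧ head e ∉ I) (heK : tail e ∉ K ∧ head e ∈ K) :
    cutCapacity tail head l u (I ∩ K) + cutCapacity tail head l u (I ∪ K) + (u e - l e) ≤
      cutCapacity tail head l u I + cutCapacity tail head l u K := by
  have hle := Finset.single_le_sum (s := Finset.univ) (a := e)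
    (fun k _ => sub_nonneg.2 (edgeCapacity_inter_add_union_le tail head (hlu k) I K))
    (Finset.mem_univ e)
  have he : edgeCapacity tail head l u I e + edgeCapacity tail head l u K e -
      (edgeCapacity tail head l u (I ∩ K) e + edgeCapacity tail head l u (I ∪ K) e) =
        u e - l e := by
    simp [edgeCapacity, heI, heK, sub_eq_add_neg]
  rw [he, Finset.sum_sub_distrib, Finset.sum_add_distrib, Finset.sum_add_distrib] at hle
  unfold cutCapacity
  grind

theorem isLeast_cutCapacity_piecewise [DecidableEq E] (l₁ l₂ u₁ u₂ : E → R) (I : Finset V) :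
    IsLeast ((fun J : Finset E =>
        cutCapacity tail head (J.piecewise l₁ l₂) (J.piecewise u₁ u₂) I) ''
          {J | ∀ e ∈ J, tail e ∈ I ↔ head e ∉ I})
      (cutCapacity tail head (l₁ ⊔ l₂) (u₁ ⊓ u₂) I) := by
  let J : Finset E :=
    {e | tail e ∈ I ∧ head e ∉ I ∧ u₁ e ≤ u₂ e ∨ tail e ∉ I ∧ head e ∈ I ∧ l₂ e ≤ l₁ e}
  refine ⟨⟨J, fun e he => ?_, Finset.sum_congr rfl fun e _ => ?_⟩, ?_⟩
  · simp only [J, Finset.mem_filter_univ] at he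
    tauto
  · simp only [edgeCapacity, Finset.piecewise, J, Finset.mem_filter_univ, Pi.sup_apply,
      Pi.inf_apply]
    grind
  · rintro _ ⟨J, -, rfl⟩
    exact cutCapacity_mono tail head (J.piecewise_le_of_le_of_le le_sup_left le_sup_right)
      (J.le_piecewise_of_le_of_le inf_le_left inf_le_right) I

/-- The cut condition of flow theory: no vertex set `I` has to send out more than the capacity of
its cut in order to meet the demands `τ`. -/
def CutCondition (l u : E → R) (τ : V → R) : Prop :=
  ∀ I : Finset V, ∑ i ∈ I, τ i ≤ cutCapacity tail head l u I

variable {tail head} {l u : E → R} {τ : V → R}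

theorem CutCondition.sub_le_slack_add_slack (h : CutCondition tail head l u τ) (hlu : l ≤ u)
    {I K : Finset V} {e : E} (heI : tail e ∈ I ∧ head e ∉ I) (heK : tail e ∉ K ∧ head e ∈ K) :
    u e - l e ≤ (cutCapacity tail head l u I - ∑ i ∈ I, τ i) +
      (cutCapacity tail head l u K - ∑ i ∈ K, τ i) := by
  have hcap := cutCapacity_inter_add_union_add_le tail head hlu heI heK
  have hinter := h (I ∩ K)
  have hunion := h (I ∪ K)
  have hsum := Finset.sum_union_inter (s₁ := I) (s₂ := K) (f := τ)
  grind

theorem CutCondition.exists_update [Finite V] [DecidableEq E] (h : CutCondition tail head l u τ)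
    (hlu : l ≤ u) (e : E) :
    ∃ v ∈ Set.Icc (l e) (u e),
      CutCondition tail head (Function.update l e v) (Function.update u e v) τ := by
  have hslack : ∀ I, ∑ i ∈ I, τ i ≤ cutCapacity tail head l u I := h
  -- `lower I` is the least value of `e` allowed by `l e` and by the demand of `I`
  let lower (I : Finset V) : R := if tail e ∈ I ∧ head e ∉ I then
    max (l e) (u e - (cutCapacity tail head l u I - ∑ i ∈ I, τ i)) else l e
  obtain ⟨I, hI⟩ := Finite.exists_max lower
  have hvI : lower I = l e ∨ (tail e ∈ I ∧ head e ∉ I) ∧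
      lower I = u e - (cutCapacity tail head l u I - ∑ i ∈ I, τ i) := by grind
  refine ⟨lower I, ⟨?_, ?_⟩, fun K => ?_⟩
  · simpa [lower] using hI ∅
  · have := hlu e
    grind
  · rw [cutCapacity_update]
    split_ifs with hleave henter
    · have := hI K
      grind
    · have := h.sub_le_slack_add_slack hlu (I := I) (K := K) (e := e)
      grind
    · simpa using h K

theorem CutCondition.netOutflow_eq [Fintype V] (h : CutCondition tail head l l τ)
    (hτ : ∑ i, τ i = 0) : netOutflow tail head l = τ := by
  have hle (i : V) : τ i ≤ netOutflow tail head l i := by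
    simpa [← sum_netOutflow] using h {i}
  have hsum : ∑ i, τ i = ∑ i, netOutflow tail head l i := by
    rw [hτ, sum_netOutflow, cutCapacity_univ]
  exact funext fun i =>
    ((Finset.sum_eq_sum_iff_of_le fun i _ => hle i).1 hsum i (Finset.mem_univ i)).symm

theorem CutCondition.exists_flow [Fintype V] (h : CutCondition tail head l u τ) (hlu : l ≤ u)
    (hτ : ∑ i, τ i = 0) : ∃ x ∈ Set.Icc l u, netOutflow tail head x = τ := by
  classical
  suffices hfix : ∀ (s : Finset E) (l u : E → R), (∀ e ∉ s, l e = u e) →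
      CutCondition tail head l u τ → l ≤ u → ∃ x ∈ Set.Icc l u, netOutflow tail head x = τ from
    hfix Finset.univ l u (by simp) h hlu
  intro s
  induction s using Finset.induction_on with
  | empty =>
    intro l u heq h hlu
    obtain rfl : l = u := funext fun e => heq e (Finset.notMem_empty e)
    exact ⟨l, by simp, h.netOutflow_eq hτ⟩
  | insert e s _ ih =>
    intro l u heq h hlu
    obtain ⟨v, ⟨hlv, hvu⟩, hv⟩ := h.exists_update hlu e
    obtain ⟨x, ⟨hlx, hxu⟩, hx⟩ := ih _ _ (fun k hk => by grind [Function.update_apply]) hv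
      (update_le_update_iff.2 ⟨le_rfl, fun k _ => hlu k⟩)
    exact ⟨x, ⟨(le_update_iff.2 ⟨hlv, fun _ _ => le_rfl⟩).trans hlx,
      hxu.trans (update_le_iff.2 ⟨hvu, fun _ _ => le_rfl⟩)⟩, hx⟩

theorem exists_flow_iff_cutCondition [Fintype V] :
    (∃ x ∈ Set.Icc l u, netOutflow tail head x = τ) ↔
      ∑ i, τ i = 0 ∧ l ≤ u ∧ CutCondition tail head l u τ := by
  refine ⟨?_, fun ⟨hτ, hlu, h⟩ => h.exists_flow hlu hτ⟩
  rintro ⟨x, ⟨hlx, hxu⟩, rfl⟩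
  refine ⟨by rw [sum_netOutflow, cutCapacity_univ], hlx.trans hxu, fun I => ?_⟩
  rw [sum_netOutflow]
  exact cutCapacity_mono tail head hlx hxu I

end Network

section Bonds

variable {V : Type*} [DecidableEq V] {G : SimpleGraph V}

-- `Gᶜ.IsCompleteBetween A B` means that `A` and `B` are disjoint with no edge of `G` between them.
theorem exists_union_eq_of_not_connected_induce {I : Finset V} (hI : I.Nonempty)
    (h : ¬ (G.induce (I : Set V)).Connected) :
    ∃ A B : Finset V, A.Nonempty ∧ B.Nonempty ∧ Gᶜ.IsCompleteBetween (A : Set V) B ∧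
      A ∪ B = I := by
  classical
  have hpre : ¬ (G.induce (I : Set V)).Preconnected := fun hp =>
    h ((SimpleGraph.connected_iff _).2 ⟨hp, hI.to_subtype⟩)
  simp only [SimpleGraph.Preconnected, not_forall] at hpre
  obtain ⟨p, q, hpq⟩ := hpre
  let A : Finset V := {v ∈ I | ∃ hv : v ∈ I, (G.induce (I : Set V)).Reachable p ⟨v, hv⟩}
  have hmem (v : (I : Set V)) : v.1 ∈ A ↔ (G.induce (I : Set V)).Reachable p v := by
    simp [A]
  refine ⟨A, I \ A, ⟨p, (hmem p).2 .rfl⟩,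
    ⟨q, Finset.mem_sdiff.2 ⟨q.2, fun hq => hpq ((hmem q).1 hq)⟩⟩, fun x hx y hy => ?_,
    Finset.union_sdiff_of_subset (Finset.filter_subset _ _)⟩
  obtain ⟨hyI, hyA⟩ := Finset.mem_sdiff.1 hy
  refine (G.compl_adj x y).2 ⟨fun hxy => hyA (hxy ▸ hx), fun hxy => hyA ?_⟩
  have hxI : x ∈ I := Finset.mem_of_mem_filter x hx
  have hadj : (G.induce (I : Set V)).Adj ⟨x, hxI⟩ ⟨y, hyI⟩ := hxy
  exact (hmem ⟨y, hyI⟩).2 (((hmem ⟨x, hxI⟩).1 hx).trans hadj.reachable)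

variable [Fintype V]

theorem interedges_compl_nonempty [DecidableRel G.Adj] (hG : G.Connected) {I : Finset V}
    (hI : I.Nonempty) (hI' : Iᶜ.Nonempty) : (G.interedges I Iᶜ).Nonempty := by
  obtain ⟨p, hp⟩ := hI
  obtain ⟨q, hq⟩ := hI'
  obtain ⟨w⟩ := hG.preconnected p q
  obtain ⟨d, -, hfst, hsnd⟩ := w.exists_boundary_dart I hp (Finset.mem_compl.1 hq)
  exact ⟨d.toProd, G.mem_interedges_iff.2 ⟨hfst, Finset.mem_compl.2 hsnd, d.adj⟩⟩

theorem card_interedges_compl_comm [DecidableRel G.Adj] (I : Finset V) :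
    (G.interedges Iᶜ Iᶜᶜ).card = (G.interedges I Iᶜ).card := by
  have := G.symm
  rw [compl_compl]
  exact Rel.card_interedges_comm _ _

theorem card_interedges_compl_lt [DecidableRel G.Adj] (hG : G.Connected) {A B : Finset V}
    (hA : A.Nonempty) (hB : B.Nonempty) (h : Gᶜ.IsCompleteBetween (A : Set V) B) :
    (G.interedges A Aᶜ).card < (G.interedges (A ∪ B) (A ∪ B)ᶜ).card := by
  have hdisj : Disjoint A B := Finset.disjoint_coe.1 h.disjoint
  have hnadj {x y : V} (hx : x ∈ A) (hy : y ∈ B) : ¬ G.Adj x y := ((G.compl_adj x y).1 (h hx hy)).2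
  obtain ⟨p, hp⟩ := interedges_compl_nonempty hG hB
    (hA.mono fun x hx => Finset.mem_compl.2 (Finset.disjoint_left.1 hdisj hx))
  refine Finset.card_lt_card
    ((Finset.ssubset_iff_of_subset fun k hk => ?_).2 ⟨p, ?_, fun hpA => ?_⟩)
  · simp only [SimpleGraph.mem_interedges_iff, Finset.mem_compl, Finset.mem_union] at hk ⊢
    exact ⟨.inl hk.1, not_or.2 ⟨hk.2.1, fun hkB => hnadj hk.1 hkB hk.2.2⟩, hk.2.2⟩
  · simp only [SimpleGraph.mem_interedges_iff, Finset.mem_compl, Finset.mem_union] at hp ⊢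
    exact ⟨.inr hp.1, not_or.2 ⟨fun hpA => hnadj hpA hp.1 hp.2.2.symm, hp.2.1⟩, hp.2.2⟩
  · exact Finset.disjoint_left.1 hdisj (G.mem_interedges_iff.1 hpA).1 (G.mem_interedges_iff.1 hp).1

-- The sets in the hypothesis `bond` are those whose cut is a bond, a minimal nonempty cut.
theorem bond_induction (hG : G.Connected) {P : Finset V → Prop} (empty : P ∅)
    (univ : P Finset.univ)
    (bond : ∀ I : Finset V, (G.induce (I : Set V)).Connected →
      (G.induce ((I : Set V)ᶜ)).Connected → P I)
    (union : ∀ A B : Finset V, Gᶜ.IsCompleteBetween (A : Set V) B → P A → P B → P (A ∪ B))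
    (compl_union : ∀ A B : Finset V, Gᶜ.IsCompleteBetween (A : Set V) B → P Aᶜ → P Bᶜ →
      P (A ∪ B)ᶜ) (I : Finset V) : P I := by
  classical
  induction hN : (G.interedges I Iᶜ).card using Nat.strong_induction_on generalizing I with
  | _ N ih =>
  rcases I.eq_empty_or_nonempty with rfl | hI
  · exact empty
  rcases Iᶜ.eq_empty_or_nonempty with hc | hc
  · rwa [(Finset.compl_eq_empty_iff I).1 hc]
  by_cases h : (G.induce (I : Set V)).Connected
  · by_cases h' : (G.induce ((I : Set V)ᶜ)).Connected
    · exact bond I h h'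
    rw [← Finset.coe_compl] at h'
    obtain ⟨A, B, hA, hB, hAB, hI'⟩ := exists_union_eq_of_not_connected_induce hc h'
    have hlt := card_interedges_compl_lt hG hA hB hAB
    have hlt' := card_interedges_compl_lt hG hB hA hAB.symm
    rw [Finset.union_comm B A] at hlt'
    rw [← compl_compl I, ← hI', card_interedges_compl_comm] at hN
    rw [← compl_compl I, ← hI']
    exact compl_union A B hAB (ih _ (by rwa [card_interedges_compl_comm, ← hN]) Aᶜ rfl)
      (ih _ (by rwa [card_interedges_compl_comm, ← hN]) Bᶜ rfl)
  · obtain ⟨A, B, hA, hB, hAB, rfl⟩ := exists_union_eq_of_not_connected_induce hI h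
    have hlt := card_interedges_compl_lt hG hA hB hAB
    have hlt' := card_interedges_compl_lt hG hB hA hAB.symm
    rw [Finset.union_comm B A] at hlt'
    exact union A B hAB (ih _ (hN ▸ hlt) A rfl) (ih _ (hN ▸ hlt') B rfl)

end Bonds

section Orientation

variable {V R : Type*} {G : SimpleGraph V}

/-- The functions `tail` and `head` orient the graph `G`: they select the two ends of every
edge. -/
def IsOrientation (tail head : G.edgeSet → V) : Prop :=
  ∀ e, s(tail e, head e) = (e : Sym2 V)

variable {tail head : G.edgeSet → V} (h : IsOrientation tail head)
include h

theorem IsOrientation.adj (e : G.edgeSet) : G.Adj (tail e) (head e) := by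
  rw [← SimpleGraph.mem_edgeSet, h e]
  exact e.2

theorem IsOrientation.exists_cut_eq_singleton {e : G.edgeSet} (he : G.IsBridge e) :
    ∃ A : Set V, tail e ∈ A ∧ head e ∉ A ∧ ∀ k ≠ e, tail k ∈ A ↔ head k ∈ A := by
  refine ⟨{v | (G.deleteEdges {(e : Sym2 V)}).Reachable (tail e) v}, .rfl, ?_, fun k hk => ?_⟩
  · rw [← h e] at he ⊢
    exact SimpleGraph.isBridge_iff.1 he
  · have hadj : (G.deleteEdges {(e : Sym2 V)}).Adj (tail k) (head k) := by
      rw [SimpleGraph.deleteEdges_adj, h k]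
      exact ⟨h.adj k, fun hke => hk (Subtype.ext hke)⟩
    exact ⟨fun ht => ht.trans hadj.reachable, fun hh => hh.trans hadj.symm.reachable⟩

variable [DecidableEq V] [Fintype G.edgeSet] [AddCommGroup R] {l u : G.edgeSet → R}

theorem IsOrientation.cutCapacity_union (l u : G.edgeSet → R) {A B : Finset V}
    (hAB : Gᶜ.IsCompleteBetween (A : Set V) B) :
    cutCapacity tail head l u (A ∪ B) =
      cutCapacity tail head l u A + cutCapacity tail head l u B := by
  rw [cutCapacity, cutCapacity, cutCapacity, ← Finset.sum_add_distrib]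
  refine Finset.sum_congr rfl fun e _ => ?_
  have hdisj {x : V} (hx : x ∈ A) : x ∉ B :=
    Finset.disjoint_left.1 (Finset.disjoint_coe.1 hAB.disjoint) hx
  have htail : ¬ (tail e ∈ A ∧ head e ∈ B) := fun he =>
    ((G.compl_adj _ _).1 (hAB he.1 he.2)).2 (h.adj e)
  have hhead : ¬ (head e ∈ A ∧ tail e ∈ B) := fun he =>
    ((G.compl_adj _ _).1 (hAB he.1 he.2)).2 (h.adj e).symm
  simp only [edgeCapacity, Finset.mem_union]
  grind

variable [Fintype V] [LinearOrder R] [IsOrderedAddMonoid R] {τ : V → R}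

theorem IsOrientation.cutCondition_of_connected (hG : G.Connected) (hτ : ∑ i, τ i = 0)
    (hbond : ∀ I : Finset V, (G.induce (I : Set V)).Connected →
      (G.induce ((I : Set V)ᶜ)).Connected → ∑ i ∈ I, τ i ≤ cutCapacity tail head l u I) :
    CutCondition tail head l u τ := by
  have hcompl (I : Finset V) : ∑ i ∈ Iᶜ, τ i = -∑ i ∈ I, τ i :=
    eq_neg_of_add_eq_zero_right (by rw [Finset.sum_add_sum_compl, hτ])
  have hsum {A B : Finset V} (hAB : Gᶜ.IsCompleteBetween (A : Set V) B) :
      ∑ i ∈ A ∪ B, τ i = ∑ i ∈ A, τ i + ∑ i ∈ B, τ i :=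
    Finset.sum_union (Finset.disjoint_coe.1 hAB.disjoint)
  refine bond_induction hG ?_ ?_ hbond (fun A B hAB hA hB => ?_) fun A B hAB hA hB => ?_
  · rw [Finset.sum_empty, cutCapacity_empty]
  · rw [hτ, cutCapacity_univ]
  · rw [hsum hAB, h.cutCapacity_union l u hAB]
    exact add_le_add hA hB
  · rw [hcompl, cutCapacity_compl] at hA hB ⊢
    rw [hsum hAB, h.cutCapacity_union _ _ hAB, neg_add]
    exact add_le_add hA hB

-- The demands of the two sides of a bridge cancel, and their capacities add up to `u e - l e`.
theorem IsOrientation.le_of_isBridge (hcut : CutCondition tail head l u τ) (hτ : ∑ i, τ i = 0)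
    {e : G.edgeSet} (he : G.IsBridge e) : l e ≤ u e := by
  classical
  obtain ⟨A, htail, hhead, hA⟩ := h.exists_cut_eq_singleton he
  have hcap : cutCapacity tail head l u A.toFinset + cutCapacity tail head l u A.toFinsetᶜ =
      u e - l e := by
    rw [cutCapacity, cutCapacity, ← Finset.sum_add_distrib, Fintype.sum_eq_single e]
    · simp [edgeCapacity, htail, hhead, sub_eq_add_neg]
    · intro k hk
      by_cases hkA : head k ∈ A <;> simp [edgeCapacity, hA k hk, hkA]
  rw [← sub_nonneg, ← hcap, ← hτ, ← Finset.sum_add_sum_compl A.toFinset τ]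
  exact add_le_add (hcut _) (hcut _)

theorem IsOrientation.exists_flow_iff_of_connected (hG : G.Connected) :
    (∃ x ∈ Set.Icc l u, netOutflow tail head x = τ) ↔
      ∑ i, τ i = 0 ∧
      (∀ I : Finset V, (G.induce (I : Set V)).Connected →
        (G.induce ((I : Set V)ᶜ)).Connected → ∑ i ∈ I, τ i ≤ cutCapacity tail head l u I) ∧
      ∀ e : G.edgeSet, (G.deleteEdges {(e : Sym2 V)}).Connected → l e ≤ u e := by
  rw [exists_flow_iff_cutCondition]
  refine and_congr_right fun hτ =>
    ⟨fun ⟨hlu, hcut⟩ => ⟨fun I _ _ => hcut I, fun e _ => hlu e⟩, fun ⟨hbond, hcycle⟩ => ?_⟩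
  have hcut := h.cutCondition_of_connected hG hτ hbond
  refine ⟨fun e => ?_, hcut⟩
  by_cases he : G.IsBridge e
  · exact h.le_of_isBridge hcut hτ he
  · refine hcycle e ?_
    rw [← h e] at he ⊢
    exact hG.connected_delete_edge_of_not_isBridge he

theorem IsOrientation.exists_eq_two_nsmul_netOutflow_iff (hG : G.Connected)
    (l u : G.edgeSet → ℤ) (t : V → ℤ) :
    (∃ x ∈ Set.Icc l u, t = 2 • netOutflow tail head x) ↔
      ((∀ i, Even (t i)) ∧ ∑ i, t i = 0) ∧
      (∀ I : Finset V, (G.induce (I : Set V)).Connected → (G.induce ((I : Set V)ᶜ)).Connected →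
        ∑ i ∈ I, t i ≤ 2 * cutCapacity tail head l u I) ∧
      ∀ e : G.edgeSet, (G.deleteEdges {(e : Sym2 V)}).Connected → l e ≤ u e := by
  by_cases heven : ∀ i, Even (t i)
  · choose τ hτ using heven
    obtain rfl : t = 2 • τ := funext fun i => by simp [hτ, two_mul]
    simp only [eq_comm (a := 2 • τ), smul_right_inj (two_ne_zero (α := ℕ)),
      h.exists_flow_iff_of_connected hG]
    simp [← Finset.mul_sum]
  · refine iff_of_false ?_ fun ht => heven ht.1.1
    rintro ⟨x, -, rfl⟩
    exact heven fun i => ⟨_, two_nsmul _⟩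

end Orientation

section Box

variable {n m : ℕ} {G : SimpleGraph (Fin n)}

theorem isOrientation_lo_hi : IsOrientation (lo (G := G)) hi := by
  rintro ⟨e, he⟩
  induction e using Sym2.ind with
  | _ x y => rcases le_total x y with hxy | hxy <;> simp [lo, hi, hxy]

theorem sum_smul_f_add_sum_smul_g (r : Fin n → ℤ) (s : Fin m → ℤ) :
    ∑ i, r i • f m i + ∑ j, s j • g n j = (r, s) := by
  ext k <;> simp [f, g, Prod.fst_sum, Prod.snd_sum, Pi.single_apply]

variable [DecidableRel G.Adj]

theorem mem_cut {I : Finset (Fin n)} {e : G.edgeSet} : e ∈ cut G I ↔ (lo e ∈ I ↔ hi e ∉ I) := by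
  simp only [cut, Finset.mem_filter_univ, ← isOrientation_lo_hi e, Sym2.eq_iff]
  grind

theorem le_two_mul_cutCapacity_sup_inf_iff (t : ℤ) (l₁ l₂ u₁ u₂ : G.edgeSet → ℤ)
    (I : Finset (Fin n)) :
    t ≤ 2 * cutCapacity lo hi (l₁ ⊔ l₂) (u₁ ⊓ u₂) I ↔ ∀ J ⊆ cut G I,
      t ≤ 2 * cutCapacity lo hi (J.piecewise l₁ l₂) (J.piecewise u₁ u₂) I := by
  obtain ⟨⟨J, hJ, hJmin⟩, hmin⟩ := isLeast_cutCapacity_piecewise lo hi l₁ l₂ u₁ u₂ I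
  refine ⟨fun h K hK => h.trans ?_, fun h => ?_⟩
  · exact mul_le_mul_of_nonneg_left (hmin ⟨K, fun e he => mem_cut.1 (hK he), rfl⟩) two_pos.le
  · rw [← hJmin]
    exact h J fun e he => mem_cut.2 (hJ e he)

theorem sum_smul_z (ε : Fin m ≃ G.edgeSet) (x : G.edgeSet → ℤ) :
    ∑ e, x e • z ε e = (netOutflow lo hi x, x ∘ ε) := by
  ext k <;> simp [z, f, g, netOutflow, Prod.fst_sum, Prod.snd_sum, Pi.single_apply,
    Finset.sum_filter, mul_sub, Equiv.symm_apply_eq, eq_comm (a := k)]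

theorem sum_smul_z' (ε : Fin m ≃ G.edgeSet) (y : G.edgeSet → ℤ) :
    ∑ e, y e • z' ε e = (-netOutflow lo hi y, y ∘ ε) := by
  ext k <;> simp [z', f, g, netOutflow, Prod.fst_sum, Prod.snd_sum, Pi.single_apply,
    Finset.sum_filter, mul_sub, Equiv.symm_apply_eq, eq_comm (a := k), neg_add_eq_sub]

theorem N₀_mulVec (ε : Fin m ≃ G.edgeSet) (s : Fin m → ℤ) :
    N₀ ε *ᵥ s = netOutflow lo hi (s ∘ ε.symm) := by
  ext i
  simp only [Matrix.mulVec, dotProduct, netOutflow, Finset.sum_filter, ← Finset.sum_sub_distrib]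
  rw [← ε.sum_comp]
  refine Finset.sum_congr rfl fun k _ => ?_
  have := (isOrientation_lo_hi.adj (ε k)).ne
  simp only [N₀, Matrix.of_apply, Function.comp_apply, Equiv.symm_apply_apply]
  grind

theorem sum_smul_eq_iff (ε : Fin m ≃ G.edgeSet) (r : Fin n → ℤ) (s : Fin m → ℤ)
    (x y : G.edgeSet → ℤ) :
    ∑ i, r i • f m i + ∑ j, s j • g n j = ∑ e, x e • z ε e + ∑ e, y e • z' ε e ↔
      y = s ∘ ε.symm - x ∧ N₀ ε *ᵥ s + r = 2 • netOutflow lo hi x := by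
  have hs : s = x ∘ ε + y ∘ ε ↔ y = s ∘ ε.symm - x := by
    rw [← Pi.add_comp, ← Equiv.comp_symm_eq, eq_sub_iff_add_eq', eq_comm]
  rw [sum_smul_f_add_sum_smul_g, sum_smul_z, sum_smul_z', Prod.mk_add_mk, Prod.mk_inj, and_comm,
    hs]
  refine and_congr_right fun hy => ?_
  rw [hy, N₀_mulVec, netOutflow_sub, neg_sub, ← eq_sub_iff_add_eq', two_nsmul, add_sub_assoc]

theorem exists_bounded_sum_smul_iff (ε : Fin m ≃ G.edgeSet) (r : Fin n → ℤ) (s : Fin m → ℤ)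
    (a b c d : G.edgeSet → ℤ) :
    (∃ x y : G.edgeSet → ℤ,
        (∀ e, a e ≤ x e ∧ x e ≤ b e) ∧ (∀ e, c e ≤ y e ∧ y e ≤ d e) ∧
        ∑ i, r i • f m i + ∑ j, s j • g n j = ∑ e, x e • z ε e + ∑ e, y e • z' ε e) ↔
      ∃ x ∈ Set.Icc (a ⊔ (s ∘ ε.symm - d)) ((s ∘ ε.symm - c) ⊓ b),
        N₀ ε *ᵥ s + r = 2 • netOutflow lo hi x := by
  have hbounds (x : G.edgeSet → ℤ) :
      x ∈ Set.Icc (a ⊔ (s ∘ ε.symm - d)) ((s ∘ ε.symm - c) ⊓ b) ↔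
        (∀ e, a e ≤ x e ∧ x e ≤ b e) ∧
          ∀ e, c e ≤ (s ∘ ε.symm - x) e ∧ (s ∘ ε.symm - x) e ≤ d e := by
    rw [Set.mem_Icc, sup_le_iff, le_inf_iff, sub_le_comm, le_sub_comm]
    simp only [Pi.le_def, forall_and]
    tauto
  simp only [sum_smul_eq_iff, hbounds]
  constructor
  · rintro ⟨x, _, hx, hy, rfl, ht⟩
    exact ⟨x, ⟨hx, hy⟩, ht⟩
  · rintro ⟨x, ⟨hx, hy⟩, ht⟩
    exact ⟨x, _, hx, hy, rfl, ht⟩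

theorem cut_inequality_iff (ε : Fin m ≃ G.edgeSet) (r : Fin n → ℤ) (s : Fin m → ℤ)
    (a b c d : G.edgeSet → ℤ) {I : Finset (Fin n)} {J : Finset G.edgeSet} (hJ : J ⊆ cut G I) :
    ∑ i ∈ I, r i + ∑ e ∈ cut G I \ J, s (ε.symm e) - ∑ e ∈ J, s (ε.symm e) ≤
          2 * (∑ e with e ∉ J ∧ lo e ∈ I ∧ hi e ∉ I, b e)
            - 2 * (∑ e with e ∈ J ∧ lo e ∉ I ∧ hi e ∈ I, a e)
            + 2 * (∑ e with e ∉ J ∧ lo e ∉ I ∧ hi e ∈ I, d e)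
            - 2 * (∑ e with e ∈ J ∧ lo e ∈ I ∧ hi e ∉ I, c e) ↔
      ∑ i ∈ I, (N₀ ε *ᵥ s + r) i ≤ 2 * cutCapacity lo hi
        (J.piecewise a (s ∘ ε.symm - d)) (J.piecewise (s ∘ ε.symm - c) b) I := by
  have hcapacity : 2 * cutCapacity lo hi
      (J.piecewise a (s ∘ ε.symm - d)) (J.piecewise (s ∘ ε.symm - c) b) I =
        2 * (∑ e with e ∉ J ∧ lo e ∈ I ∧ hi e ∉ I, b e)
          - 2 * (∑ e with e ∈ J ∧ lo e ∉ I ∧ hi e ∈ I, a e)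
          + 2 * (∑ e with e ∉ J ∧ lo e ∉ I ∧ hi e ∈ I, d e)
          - 2 * (∑ e with e ∈ J ∧ lo e ∈ I ∧ hi e ∉ I, c e)
          - ∑ e ∈ cut G I \ J, s (ε.symm e) + ∑ e ∈ J, s (ε.symm e)
          + cutCapacity lo hi (s ∘ ε.symm) (s ∘ ε.symm) I := by
    rw [← Finset.univ_inter (cut G I \ J), ← Finset.univ_inter J, ← Finset.sum_ite_mem,
      ← Finset.sum_ite_mem]
    simp only [cutCapacity, Finset.sum_filter, Finset.mul_sum, ← Finset.sum_add_distrib,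
      ← Finset.sum_sub_distrib]
    refine Finset.sum_congr rfl fun e _ => ?_
    have hcross := fun he : e ∈ J => mem_cut.1 (hJ he)
    simp only [edgeCapacity, Finset.piecewise, Finset.mem_sdiff, mem_cut, Pi.sub_apply,
      Function.comp_apply]
    grind
  have hdemand : ∑ i ∈ I, (N₀ ε *ᵥ s + r) i =
      cutCapacity lo hi (s ∘ ε.symm) (s ∘ ε.symm) I + ∑ i ∈ I, r i := by
    simp only [Pi.add_apply, Finset.sum_add_distrib, N₀_mulVec, sum_netOutflow]
  rw [hcapacity, hdemand]
  omega

end Box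

end EdgeBox

theorem theorem4p11 {n m : ℕ} (G : SimpleGraph (Fin n)) [DecidableRel G.Adj]
    (hG : G.Connected) (ε : Fin m ≃ G.edgeSet)
    (r : Fin n → ℤ) (s : Fin m → ℤ) (a b c d : G.edgeSet → ℤ)
    (hab : ∀ e, a e ≤ b e) (hcd : ∀ e, c e ≤ d e) :
    (∃ x y : G.edgeSet → ℤ,
        (∀ e, a e ≤ x e ∧ x e ≤ b e) ∧ (∀ e, c e ≤ y e ∧ y e ≤ d e) ∧
        ∑ i, r i • EdgeBox.f m i + ∑ j, s j • EdgeBox.g n j =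
          ∑ e, x e • EdgeBox.z ε e + ∑ e, y e • EdgeBox.z' ε e) ↔
      ((∀ i, Even ((EdgeBox.N₀ ε *ᵥ s + r) i)) ∧ ∑ i, (EdgeBox.N₀ ε *ᵥ s + r) i = 0) ∧
      (∀ (I : Finset (Fin n)) (J : Finset G.edgeSet),
        I.Nonempty → I ≠ Finset.univ → J ⊆ EdgeBox.cut G I →
        (G.induce (I : Set (Fin n))).Connected →
        (G.induce ((I : Set (Fin n))ᶜ)).Connected →
        ∑ i ∈ I, r i + ∑ e ∈ EdgeBox.cut G I \ J, s (ε.symm e) - ∑ e ∈ J, s (ε.symm e) ≤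
          2 * (∑ e with e ∉ J ∧ EdgeBox.lo e ∈ I ∧ EdgeBox.hi e ∉ I, b e)
            - 2 * (∑ e with e ∈ J ∧ EdgeBox.lo e ∉ I ∧ EdgeBox.hi e ∈ I, a e)
            + 2 * (∑ e with e ∉ J ∧ EdgeBox.lo e ∉ I ∧ EdgeBox.hi e ∈ I, d e)
            - 2 * (∑ e with e ∈ J ∧ EdgeBox.lo e ∈ I ∧ EdgeBox.hi e ∉ I, c e)) ∧
      (∀ k : Fin m, (G.deleteEdges {(ε k : Sym2 (Fin n))}).Connected →
        a (ε k) + c (ε k) ≤ s k ∧ s k ≤ b (ε k) + d (ε k)) := by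
  rw [EdgeBox.exists_bounded_sum_smul_iff,
    EdgeBox.isOrientation_lo_hi.exists_eq_two_nsmul_netOutflow_iff hG]
  refine and_congr_right fun _ => and_congr ?_ ?_
  · simp only [EdgeBox.le_two_mul_cutCapacity_sup_inf_iff]
    refine ⟨fun h I J _ _ hJ hI hI' => ?_, fun h I hI hI' J hJ => ?_⟩
    · exact (EdgeBox.cut_inequality_iff ε r s a b c d hJ).2 (h I hI hI' J hJ)
    · have hne : I ≠ Finset.univ := by
        rintro rfl
        simpa using hI'.nonempty
      exact (EdgeBox.cut_inequality_iff ε r s a b c d hJ).1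
        (h I J (Finset.nonempty_coe_sort.1 hI.nonempty) hne hJ hI hI')
  · rw [ε.surjective.forall]
    refine forall_congr' fun k => imp_congr_right fun _ => ?_
    have hab := hab (ε k)
    have hcd := hcd (ε k)
    simp only [Pi.sup_apply, Pi.inf_apply, Pi.sub_apply, Function.comp_apply,
      Equiv.symm_apply_apply]
    lia
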